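/- Consider a particle in $\mathbb{R}^3$ with position $q$ and momentum $p$, $[q_j,p_n]=i\delta_{jn}$, and a Bose field $a_j(k)$, $k\in\mathbb{R}^3$, $j\in\{1,2,3\}$, $[a_j(k),a_n^\dagger(k')]=\delta_{jn}\,\delta(k-k')$, in its Fock representation with vacuum $\Omega$. Let $\omega(k)=|k|$, $\tilde\omega(k)=\omega(k)+\tfrac12 k^2$ and $H_0=\int\omega(k)\,a^\dagger(k)a(k)\,dk+\tfrac12p^2$. For real $\lambda\neq0$ define the collective operators $$a_{\lambda,j}(t,k)=\frac1\lambda\,e^{i\frac{t}{\lambda^2}H_0}\,e^{-ikq}\,a_j(k)\,e^{-i\frac{t}{\lambda^2}H_0},$$ let $a^\dagger_{\lambda,j}(t,k)$ be their adjoints, and put $a^0=a$, $a^1=a^\dagger$ and $q_\lambda(\tau,x)=e^{-i\frac{\tau}{\lambda^2}x}$. Let $\langle\,\cdot\,\rangle$ be the vacuum expectation over the field; its values are operators on the particle space $L^2(\mathbb{R}^3)$, here functions of the particle momentum $p$. Fix $N$, $\varepsilon\in\{0,1\}^N$, times $t_1,\dots,t_N\in\mathbb{R}$ and polarization indices $j_1,\dots,j_N$.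 Then the correlator $$\langle a^{\varepsilon_1}_{\lambda,j_1}(t_1,k_1)\cdots a^{\varepsilon_N}_{\lambda,j_N}(t_N,k_N)\rangle ,$$ understood as a distribution in $k_1,\dots,k_N$ (each factor is smeared with a Schwartz function of $k_m$; the annihilation integrals that occur when the product is applied to a vector $\psi\otimes\Omega$ converge absolutely), has the following form. (i) If the number of creators ($\varepsilon_m=1$) differs from the number of annihilators ($\varepsilon_m=0$), it is zero. (ii) If both numbers are equal to $n$ (so $N=2n$), it equals $$\sum_{\sigma}\ \prod_{h=1}^{n}\delta_{j_{m_h}j_{m'_h}}\,\delta(k_{m_h}-k_{m'_h})\,\frac1{\lambda^2}\,q_\lambda\Big(t_{m_h}-t_{m'_h},\ \tilde\omega(k_{m_h})+k_{m_h}\cdot p+\sum_{\alpha:\ m_\alpha<m_h<m'_h<m'_\alpha}k_{m_\alpha}\cdot k_{m_h}\Big)\ \prod_{(i,j):\ m_j<m_i<m'_j<m'_i}q_\lambda\big(t_{m_i}-t_{m'_j},\ k_{m_i}\cdot k_{m_j}\big),$$ where $\sigma=\{(m_h,m'_h):h=1,\dots,n\}$ runs over all partitions of $\{1,\dots,2n\}$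 into pairs with $m_h<m'_h$, $\varepsilon_{m_h}=0$ and $\varepsilon_{m'_h}=1$. The inner sum is over the pairs that enclose the pair $(m_h,m'_h)$; the last product is over the crossing pairs of pairs. -/

import Mathlib

open MeasureTheory
open scoped SchwartzMap

/-- Momentum space of the particle and of the field quanta. -/
abbrev Mom : Type := EuclideanSpace ℝ (Fin 3)

/-- Wave functions of the coupled system in the momentum representation: the component
`Ψ n p x` is the amplitude for particle momentum `p` and `n` field quanta, where
`x i = (k_i, j_i)` lists their momenta and polarization indices. -/
abbrev FockFn : Type := (n : ℕ) → Mom → (Fin n → Mom × Fin 3) → ℂ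

noncomputable section

/-- Dispersion law `ω(k) = |k|`. -/
def omega (k : Mom) : ℝ := ‖k‖

/-- `ω̃(k) = ω(k) + k² / 2`. -/
def omegaTilde (k : Mom) : ℝ := omega k + ‖k‖ ^ 2 / 2

/-- The oscillating exponent `q_λ(τ, x) = exp (-i (τ / λ²) x)`. -/
def qFactor (lam τ x : ℝ) : ℂ :=
  Complex.exp (-Complex.I * ((τ / lam ^ 2 * x : ℝ) : ℂ))

/-- `H₀ = ∫ ω(k) a†(k) a(k) dk + p² / 2` is multiplication by this function on the `n`-quanta
sector. -/
def freeEnergy {n : ℕ} (p : Mom) (x : Fin n → Mom × Fin 3) : ℝ :=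
  ∑ i, omega (x i).1 + ‖p‖ ^ 2 / 2

/-- `e^{i s H₀}`. -/
def freeEvolution (s : ℝ) (Ψ : FockFn) : FockFn := fun _ p x =>
  Complex.exp (Complex.I * ((s * freeEnergy p x : ℝ) : ℂ)) * Ψ _ p x

/-- `e^{i k q}`, where `q = i ∂/∂p` is the position operator of the particle: it translates the
particle momentum, `e^{-i k q} p = (p + k) e^{-i k q}`. -/
def expPosition (k : Mom) (Ψ : FockFn) : FockFn := fun _ p x => Ψ _ (p - k) x

/-- The Bose annihilation operator `a_j(k)` at sharp momentum `k`. -/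
def annihilate (j : Fin 3) (k : Mom) (Ψ : FockFn) : FockFn := fun n p x =>
  (Real.sqrt (n + 1) : ℂ) * Ψ (n + 1) p (Fin.cons (k, j) x)

/-- The collective annihilator at sharp momentum,
`a_{λ,j}(t,k) = λ⁻¹ e^{i (t/λ²) H₀} e^{-i k q} a_j(k) e^{-i (t/λ²) H₀}`. -/
def collectiveAnnihilator (lam t : ℝ) (j : Fin 3) (k : Mom) (Ψ : FockFn) : FockFn :=
  fun n p x => (lam : ℂ)⁻¹ *
    freeEvolution (t / lam ^ 2)
      (expPosition (-k) (annihilate j k (freeEvolution (-(t / lam ^ 2)) Ψ))) n p x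

/-- The smeared collective annihilator `∫ f(k) a_{λ,j}(t,k) dk`. -/
def smearedAnnihilator (lam t : ℝ) (j : Fin 3) (f : Mom → ℂ) (Ψ : FockFn) : FockFn :=
  fun n p x => ∫ k, f k * collectiveAnnihilator lam t j k Ψ n p x

/-- `∫ f(k) a†_j(k) e^{i k q} dk`, where
`(a†_j(k) Φ)_{n+1}(p, x) = (n+1)^{-1/2} ∑ i, δ(k - k_i) δ_{j j_i} Φ_n(p, x without x_i)`. -/
def smearedCreate (j : Fin 3) (f : Mom → ℂ) (Ψ : FockFn) : FockFn
  | 0 => fun _ _ => 0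
  | n + 1 => fun p x => (Real.sqrt (n + 1) : ℂ)⁻¹ *
      ∑ i : Fin (n + 1), if (x i).2 = j then
        f (x i).1 * expPosition (x i).1 Ψ n p (i.removeNth x) else 0

/-- The smeared collective creator `∫ f(k) a†_{λ,j}(t,k) dk`, where
`a†_{λ,j}(t,k) = λ⁻¹ e^{i (t/λ²) H₀} a†_j(k) e^{i k q} e^{-i (t/λ²) H₀}` is the formal adjoint of
`a_{λ,j}(t,k)`. -/
def smearedCreator (lam t : ℝ) (j : Fin 3) (f : Mom → ℂ) (Ψ : FockFn) : FockFn :=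
  fun n p x => (lam : ℂ)⁻¹ *
    freeEvolution (t / lam ^ 2)
      (smearedCreate j f (freeEvolution (-(t / lam ^ 2)) Ψ)) n p x

/-- `∫ f(k) a^ε_{λ,j}(t,k) dk`: annihilator for `ε = 0`, creator for `ε = 1`. -/
def smearedOp (lam : ℝ) (ε : Fin 2) (t : ℝ) (j : Fin 3) (f : Mom → ℂ) : FockFn → FockFn :=
  if ε = 0 then smearedAnnihilator lam t j f else smearedCreator lam t j f

/-- The product of the operators number `m₀, m₀ + 1, …, N - 1` (counted from `0`) among
`∫ f_m(k) a^{ε_m}_{λ,j_m}(t_m,k) dk`; for `m₀ = 0` it is the product of all of them. -/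
def monomialFrom (lam : ℝ) {N : ℕ} (ε : Fin N → Fin 2) (t : Fin N → ℝ) (j : Fin N → Fin 3)
    (f : Fin N → Mom → ℂ) (m₀ : ℕ) : FockFn → FockFn :=
  ((List.ofFn fun m => smearedOp lam (ε m) (t m) (j m) (f m)).drop m₀).foldr (· ∘ ·) id

/-- `ψ ⊗ Ω`: the particle has wave function `ψ` and the field is in its vacuum `Ω`. -/
def vacuumVector (ψ : Mom → ℂ) : FockFn
  | 0 => fun p _ => ψ p
  | _ + 1 => fun _ _ => 0

/-- The vacuum expectation `⟨X⟩` over the field, an operator on the wave functions of the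
particle: `⟨φ, ⟨X⟩ ψ⟩ = ⟨φ ⊗ Ω, X (ψ ⊗ Ω)⟩`, so `⟨X⟩ ψ` is the zero-quanta component of
`X (ψ ⊗ Ω)`. -/
def vacuumExpectation (X : FockFn → FockFn) (ψ : Mom → ℂ) : Mom → ℂ :=
  fun p => X (vacuumVector ψ) 0 p Fin.elim0

/-- Positions of the annihilators. -/
abbrev Ann {N : ℕ} (ε : Fin N → Fin 2) : Type := {m : Fin N // ε m = 0}

/-- Positions of the creators. -/
abbrev Cre {N : ℕ} (ε : Fin N → Fin 2) : Type := {m : Fin N // ε m = 1}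

/-- The pair partitions of the positions that are associated with `ε`: every pair consists of an
annihilator `m` and a creator `m' = σ m` with `m < m'`. -/
def pairPartitions {N : ℕ} (ε : Fin N → Fin 2) : Finset (Ann ε ≃ Cre ε) :=
  Finset.univ.filter fun σ => ∀ m : Ann ε, m.1 < (σ m).1

/-- The point `(k_1, …, k_N)` with `k_m = k_{σ m} = κ m` for all annihilators `m`. -/
def diagonalPoint {N : ℕ} {ε : Fin N → Fin 2} (σ : Ann ε ≃ Cre ε) (κ : Ann ε → Mom)
    (i : Fin N) : Mom :=
  if h : ε i = 0 then κ ⟨i, h⟩ else κ (σ.symm ⟨i, by omega⟩)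

/-- The distribution `∏_h δ(k_{m_h} - k_{m'_h})` in the variables `k_1, …, k_N`, a measure: the
image of Lebesgue measure on the diagonal `k_{m_h} = k_{m'_h}` parametrized by `(k_{m_h})_h`. -/
def deltaMeasure {N : ℕ} {ε : Fin N → Fin 2} (σ : Ann ε ≃ Cre ε) : Measure (Fin N → Mom) :=
  Measure.map (diagonalPoint σ) (volume : Measure (Ann ε → Mom))

/-- The factor of one pair partition that multiplies the delta functions, as a function of the
particle momentum `p`. The inner sum is over the pairs that enclose the pair of `h`, the last
product is over the crossing pairs, `c = (m_j, m_i)`. -/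
def pairingKernel (lam : ℝ) {N : ℕ} {ε : Fin N → Fin 2} (σ : Ann ε ≃ Cre ε) (t : Fin N → ℝ)
    (j : Fin N → Fin 3) (k : Fin N → Mom) (p : Mom) : ℂ :=
  (∏ h : Ann ε, (if j h.1 = j (σ h).1 then (1 : ℂ) else 0) *
    (((lam : ℂ) ^ 2)⁻¹ * qFactor lam (t h.1 - t (σ h).1)
      (omegaTilde (k h.1) + inner ℝ (k h.1) p +
        ∑ α ∈ Finset.univ.filter (fun α : Ann ε => α.1 < h.1 ∧ (σ h).1 < (σ α).1),
          inner ℝ (k α.1) (k h.1)))) *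
  ∏ c ∈ Finset.univ.filter (fun c : Ann ε × Ann ε =>
      c.1.1 < c.2.1 ∧ c.2.1 < (σ c.1).1 ∧ (σ c.1).1 < (σ c.2).1),
    qFactor lam (t c.2.1 - t (σ c.1).1) (inner ℝ (k c.2.1) (k c.1.1))

end

/-! In the momentum representation a collective annihilator or creator adds or removes an argument
`k`, shifts the particle momentum by `k`, and multiplies by a phase: conjugating `H₀` leaves only
the energy of the quantum and the recoil term `k · p`, with `p` the particle momentum on the side
where the quantum is absent. Hence particle momentum minus total field momentum, called `P` below,
is conserved. So `ψ` enters only as the factor `ψ P`, and `ψ` may be replaced by the constant 1, for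
which all components are measurable and bounded (`hasAmplitude_monomialFrom`,
`isTame_monomialFrom`).

By Fubini all annihilation integrals move to the front (`monomialFrom_zero_eq_integral`). At sharp
momenta each creator is a finite sum over the quanta present, which amounts to choosing the
annihilator it is contracted with. Downward induction along the product gives Wick's formula
`sharpMonomialFrom_apply`: a sum over contractions of products with one factor per operator, the
phase at position `i` being evaluated at `P` plus the momenta of the pairs that straddle `i`.

In the vacuum sector contractions are pair partitions and `P = p`. A pair enclosing another
straddles both of its members, so its phase carries the time difference of the enclosed pair. In a
crossing `m_j < m_i < m'_j < m'_i` the pair `j` straddles only `m_i` and the pair `i` only `m'_j`;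
these two phases combine to the time difference `t_{m_i} - t_{m'_j}` (`qFactor_pair`,
`prod_crossing`). With unequal numbers of creators and annihilators there is no pair partition. -/

/-! ### Explicit action of the collective operators and algebra of the phases. -/

theorem freeEnergy_cons {n : ℕ} (p k : Mom) (j : Fin 3) (x : Fin n → Mom × Fin 3) :
    freeEnergy (p + k) (Fin.cons (k, j) x : Fin (n + 1) → Mom × Fin 3) =
      freeEnergy p x + (omegaTilde k + inner ℝ k p) := by
  simp only [freeEnergy, omegaTilde, Fin.sum_univ_succ, Fin.cons_zero, Fin.cons_succ,
    norm_add_sq_real, real_inner_comm k p]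
  ring

theorem freeEnergy_removeNth {n : ℕ} (p : Mom) (i : Fin (n + 1)) (x : Fin (n + 1) → Mom × Fin 3) :
    freeEnergy p x = freeEnergy (p - (x i).1) (i.removeNth x) +
      (omegaTilde (x i).1 + inner ℝ (x i).1 (p - (x i).1)) := by
  simp only [freeEnergy, omegaTilde, Fin.sum_univ_succAbove _ i, Fin.removeNth,
    norm_sub_sq_real, inner_sub_right, real_inner_self_eq_norm_sq, real_inner_comm (x i).1 p]
  ring

/-- The two free evolutions cancel up to the energy of the removed quantum; the cross term of `‖p +
k‖ ^ 2 / 2` is the recoil. -/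
theorem collectiveAnnihilator_apply (lam t : ℝ) (j : Fin 3) (k : Mom) (Ψ : FockFn) (n : ℕ)
    (p : Mom) (x : Fin n → Mom × Fin 3) :
    collectiveAnnihilator lam t j k Ψ n p x = (lam : ℂ)⁻¹ * (Real.sqrt (n + 1) : ℂ) *
      qFactor lam t (omegaTilde k + inner ℝ k p) * Ψ (n + 1) (p + k) (Fin.cons (k, j) x) := by
  have h : qFactor lam t (omegaTilde k + inner ℝ k p) =
      Complex.exp (Complex.I * ((t / lam ^ 2 * freeEnergy p x : ℝ) : ℂ)) *
      Complex.exp (Complex.I * ((-(t / lam ^ 2) *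
        freeEnergy (p + k) (Fin.cons (k, j) x : Fin (n + 1) → Mom × Fin 3) : ℝ) : ℂ)) := by
    rw [qFactor, ← Complex.exp_add, freeEnergy_cons]
    congr 1
    push_cast
    ring
  simp only [collectiveAnnihilator, freeEvolution, expPosition, annihilate, sub_neg_eq_add, h]
  ring

theorem smearedCreator_zero (lam t : ℝ) (j : Fin 3) (f : Mom → ℂ) (Ψ : FockFn) (p : Mom)
    (x : Fin 0 → Mom × Fin 3) : smearedCreator lam t j f Ψ 0 p x = 0 := by
  simp [smearedCreator, freeEvolution, smearedCreate]

/-- The phase has the opposite time and uses the particle momentum before emission, so both members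
of a pair see the same kind of argument. -/
theorem smearedCreator_succ (lam t : ℝ) (j : Fin 3) (f : Mom → ℂ) (Ψ : FockFn) (n : ℕ)
    (p : Mom) (x : Fin (n + 1) → Mom × Fin 3) :
    smearedCreator lam t j f Ψ (n + 1) p x = (lam : ℂ)⁻¹ * (Real.sqrt (n + 1) : ℂ)⁻¹ *
      ∑ i : Fin (n + 1), if (x i).2 = j then
        f (x i).1 * qFactor lam (-t) (omegaTilde (x i).1 + inner ℝ (x i).1 (p - (x i).1)) *
          Ψ n (p - (x i).1) (i.removeNth x) else 0 := by
  have h (i : Fin (n + 1)) :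
      qFactor lam (-t) (omegaTilde (x i).1 + inner ℝ (x i).1 (p - (x i).1)) =
      Complex.exp (Complex.I * ((t / lam ^ 2 * freeEnergy p x : ℝ) : ℂ)) *
      Complex.exp (Complex.I * ((-(t / lam ^ 2) *
        freeEnergy (p - (x i).1) (i.removeNth x) : ℝ) : ℂ)) := by
    rw [qFactor, ← Complex.exp_add, freeEnergy_removeNth p i x]
    congr 1
    push_cast
    ring
  simp only [smearedCreator, freeEvolution, smearedCreate, expPosition, h, Finset.mul_sum, mul_ite,
    mul_zero]
  refine Finset.sum_congr rfl fun i _ => ?_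
  split_ifs
  · ring
  · rfl

theorem norm_qFactor (lam τ x : ℝ) : ‖qFactor lam τ x‖ = 1 := by
  rw [qFactor, neg_mul, ← mul_neg, ← Complex.ofReal_neg, mul_comm]
  exact Complex.norm_exp_ofReal_mul_I _

theorem qFactor_add_right (lam τ x y : ℝ) :
    qFactor lam τ (x + y) = qFactor lam τ x * qFactor lam τ y := by
  rw [qFactor, qFactor, qFactor, ← Complex.exp_add]
  congr 1
  push_cast
  ring

theorem qFactor_add_left (lam τ τ' x : ℝ) :
    qFactor lam (τ + τ') x = qFactor lam τ x * qFactor lam τ' x := by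
  rw [qFactor, qFactor, qFactor, ← Complex.exp_add]
  congr 1
  push_cast
  ring

theorem qFactor_sum {ι : Type*} (s : Finset ι) (lam τ : ℝ) (x : ι → ℝ) :
    qFactor lam τ (∑ i ∈ s, x i) = ∏ i ∈ s, qFactor lam τ (x i) := by
  classical
  induction s using Finset.induction_on with
  | empty => simp [qFactor]
  | insert a s ha ih => rw [Finset.sum_insert ha, Finset.prod_insert ha, qFactor_add_right, ih]

@[fun_prop]
theorem continuous_qFactor (lam τ : ℝ) : Continuous (qFactor lam τ) := by
  unfold qFactor
  fun_prop

@[fun_prop]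
theorem continuous_omegaTilde : Continuous omegaTilde := by
  unfold omegaTilde omega
  fun_prop

/-! ### Measurability and domination of the Fock components. -/

/-- A family of Fock vectors, jointly measurable in the parameter and all momenta, whose
components are dominated by a function of the parameter. -/
structure IsTame {Θ : Type*} [MeasurableSpace Θ] (g : Θ → ℝ) (V : Θ → FockFn) : Prop where
  measurable : ∀ n, Measurable fun z : Θ × Mom × (Fin n → Mom × Fin 3) => V z.1 n z.2.1 z.2.2
  bound : ∀ n, ∃ C, 0 ≤ C ∧ ∀ θ p x, ‖V θ n p x‖ ≤ C * g θ

section Tame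

variable {Θ : Type*} [MeasurableSpace Θ]

/-- The amplitude is the constant 1 because a general `ψ` is neither measurable nor bounded;
`HasAmplitude` restores `ψ` afterwards. -/
theorem isTame_vacuumVector :
    IsTame (fun _ : Θ => 1) (fun _ => vacuumVector fun _ => 1) where
  measurable n := by
    cases n <;> exact measurable_const
  bound n := by
    refine ⟨1, zero_le_one, fun θ p x => ?_⟩
    cases n <;> simp [vacuumVector]

theorem IsTame.smearedCreator {g : Θ → ℝ} {V : Θ → FockFn} (hV : IsTame g V) (lam t : ℝ)
    (j : Fin 3) (f : 𝓢(Mom, ℂ)) :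
    IsTame g fun θ => smearedCreator lam t j f (V θ) where
  measurable n := by
    cases n with
    | zero => simp only [smearedCreator_zero]; exact measurable_const
    | succ n =>
      simp only [smearedCreator_succ]
      refine Measurable.const_mul (Finset.measurable_fun_sum _ fun i _ => ?_) _
      have hx : Measurable fun z : Θ × Mom × (Fin (n + 1) → Mom × Fin 3) => (z.2.2 i).1 := by
        fun_prop
      have hp : Measurable fun z : Θ × Mom × (Fin (n + 1) → Mom × Fin 3) =>
        z.2.1 - (z.2.2 i).1 := by fun_prop
      refine Measurable.ite ?_ (Measurable.mul (Measurable.mul ?_ ?_) ?_) measurable_const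
      · have : Measurable fun z : Θ × Mom × (Fin (n + 1) → Mom × Fin 3) => (z.2.2 i).2 := by
          fun_prop
        exact this (measurableSet_singleton j)
      · exact f.continuous.measurable.comp hx
      · exact (continuous_qFactor _ _).measurable.comp
          ((continuous_omegaTilde.measurable.comp hx).add (hx.inner hp))
      · exact (hV.measurable n).comp (measurable_fst.prodMk (hp.prodMk
          (measurable_pi_lambda _ fun l => (measurable_pi_apply _).comp
            measurable_snd.snd)))
  bound n := by
    cases n with
    | zero =>
      obtain ⟨C, hC, h⟩ := hV.bound 0
      refine ⟨C, hC, fun θ p x => ?_⟩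
      rw [smearedCreator_zero, norm_zero]
      exact (norm_nonneg _).trans (h θ p x)
    | succ n =>
      obtain ⟨C, hC, h⟩ := hV.bound n
      set B := SchwartzMap.seminorm ℝ 0 0 f
      have hB (k : Mom) : ‖f k‖ ≤ B := SchwartzMap.norm_le_seminorm ℝ f k
      have hB0 : 0 ≤ B := (norm_nonneg _).trans (hB 0)
      refine ⟨‖(lam : ℂ)⁻¹ * (Real.sqrt (n + 1) : ℂ)⁻¹‖ * ((n + 1 : ℕ) * (B * C)), by positivity,
        fun θ p x => ?_⟩
      rw [smearedCreator_succ, norm_mul, mul_assoc]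
      refine mul_le_mul_of_nonneg_left ?_ (norm_nonneg _)
      have : ∀ i ∈ (Finset.univ : Finset (Fin (n + 1))), ‖if (x i).2 = j then
          f (x i).1 * qFactor lam (-t) (omegaTilde (x i).1 + inner ℝ (x i).1 (p - (x i).1)) *
          V θ n (p - (x i).1) (i.removeNth x) else 0‖ ≤ B * C * g θ := by
        intro i _
        have hVn := h θ (p - (x i).1) (i.removeNth x)
        split_ifs
        · rw [norm_mul, norm_mul, norm_qFactor, mul_one, mul_assoc]
          exact mul_le_mul (hB _) hVn (norm_nonneg _) hB0
        · rw [norm_zero, mul_assoc]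
          exact mul_nonneg hB0 ((norm_nonneg _).trans hVn)
      refine (norm_sum_le_of_le _ this).trans (le_of_eq ?_)
      simp [mul_assoc]

theorem IsTame.measurable_collectiveAnnihilator {g : Θ → ℝ} {V : Θ → FockFn} (hV : IsTame g V)
    (lam t : ℝ) (j : Fin 3) (n : ℕ) :
    Measurable fun z : (Θ × Mom × (Fin n → Mom × Fin 3)) × Mom =>
      collectiveAnnihilator lam t j z.2 (V z.1.1) n z.1.2.1 z.1.2.2 := by
  simp only [collectiveAnnihilator_apply]
  have hp : Measurable fun z : (Θ × Mom × (Fin n → Mom × Fin 3)) × Mom => z.1.2.1 := by fun_prop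
  refine Measurable.mul (Measurable.const_mul ?_ _) ?_
  · exact (continuous_qFactor _ _).measurable.comp
      ((continuous_omegaTilde.measurable.comp measurable_snd).add (measurable_snd.inner hp))
  · refine (hV.measurable (n + 1)).comp (measurable_fst.fst.prodMk ((hp.add measurable_snd).prodMk
      (measurable_pi_lambda _ fun l => ?_)))
    cases l using Fin.cases with
    | zero =>
      exact (measurable_snd.prodMk measurable_const :
        Measurable fun z : (Θ × Mom × (Fin n → Mom × Fin 3)) × Mom => (z.2, j))
    | succ l => exact (measurable_pi_apply l).comp measurable_fst.snd.snd

theorem IsTame.exists_norm_collectiveAnnihilator_le {g : Θ → ℝ} {V : Θ → FockFn}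
    (hV : IsTame g V) (lam t : ℝ) (j : Fin 3) (n : ℕ) :
    ∃ C, 0 ≤ C ∧ ∀ θ p x k, ‖collectiveAnnihilator lam t j k (V θ) n p x‖ ≤ C * g θ := by
  obtain ⟨C, hC, h⟩ := hV.bound (n + 1)
  refine ⟨‖(lam : ℂ)⁻¹ * (Real.sqrt (n + 1) : ℂ)‖ * C, by positivity, fun θ p x k => ?_⟩
  rw [collectiveAnnihilator_apply, norm_mul, norm_mul _ (qFactor _ _ _), norm_qFactor, mul_one,
    mul_assoc]
  exact mul_le_mul_of_nonneg_left (h _ _ _) (norm_nonneg _)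

theorem IsTame.integrable_annihilator {g : Θ → ℝ} {V : Θ → FockFn} (hV : IsTame g V)
    (lam t : ℝ) (j : Fin 3) (f : 𝓢(Mom, ℂ)) (θ : Θ) (n : ℕ) (p : Mom)
    (x : Fin n → Mom × Fin 3) :
    Integrable fun k : Mom => f k * collectiveAnnihilator lam t j k (V θ) n p x := by
  obtain ⟨C, hC, h⟩ := hV.exists_norm_collectiveAnnihilator_le lam t j n
  refine f.integrable.mul_bdd (c := C * g θ) ?_ (.of_forall fun k => h θ p x k)
  exact ((hV.measurable_collectiveAnnihilator lam t j n).comp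
    (measurable_const.prodMk measurable_id :
      Measurable fun k : Mom => (((θ, p, x) : Θ × Mom × (Fin n → Mom × Fin 3)), k))
    ).aestronglyMeasurable

theorem IsTame.smearedAnnihilator {g : Θ → ℝ} {V : Θ → FockFn} (hV : IsTame g V) (lam t : ℝ)
    (j : Fin 3) (f : 𝓢(Mom, ℂ)) :
    IsTame g fun θ => smearedAnnihilator lam t j f (V θ) where
  measurable n := by
    refine StronglyMeasurable.measurable (StronglyMeasurable.integral_prod_right
      (f := fun (z : Θ × Mom × (Fin n → Mom × Fin 3)) k =>
        f k * collectiveAnnihilator lam t j k (V z.1) n z.2.1 z.2.2) ?_)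
    exact ((f.continuous.measurable.comp measurable_snd).mul
      (hV.measurable_collectiveAnnihilator lam t j n)).stronglyMeasurable
  bound n := by
    obtain ⟨C, hC, h⟩ := hV.exists_norm_collectiveAnnihilator_le lam t j n
    refine ⟨(∫ k, ‖f k‖) * C, mul_nonneg (integral_nonneg fun _ => norm_nonneg _) hC,
      fun θ p x => ?_⟩
    rw [mul_assoc, ← integral_mul_const]
    refine norm_integral_le_of_norm_le (f.integrable.norm.mul_const _) (.of_forall fun k => ?_)
    rw [norm_mul]
    exact mul_le_mul_of_nonneg_left (h _ _ _ _) (norm_nonneg _)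

theorem IsTame.smearedOp {g : Θ → ℝ} {V : Θ → FockFn} (hV : IsTame g V) (lam : ℝ) (ε : Fin 2)
    (t : ℝ) (j : Fin 3) (f : 𝓢(Mom, ℂ)) :
    IsTame g fun θ => smearedOp lam ε t j f (V θ) := by
  unfold _root_.smearedOp
  split_ifs
  · exact hV.smearedAnnihilator lam t j f
  · exact hV.smearedCreator lam t j f

end Tame

theorem monomialFrom_of_le (lam : ℝ) {N : ℕ} (ε : Fin N → Fin 2) (t : Fin N → ℝ)
    (j : Fin N → Fin 3) (f : Fin N → Mom → ℂ) {m : ℕ} (hm : N ≤ m) :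
    monomialFrom lam ε t j f m = id := by
  rw [monomialFrom, List.drop_eq_nil_of_le (by simpa using hm), List.foldr_nil]

theorem monomialFrom_of_lt (lam : ℝ) {N : ℕ} (ε : Fin N → Fin 2) (t : Fin N → ℝ)
    (j : Fin N → Fin 3) (f : Fin N → Mom → ℂ) {m : ℕ} (hm : m < N) :
    monomialFrom lam ε t j f m = smearedOp lam (ε ⟨m, hm⟩) (t ⟨m, hm⟩) (j ⟨m, hm⟩) (f ⟨m, hm⟩) ∘
      monomialFrom lam ε t j f (m + 1) := by
  rw [monomialFrom, List.drop_eq_getElem_cons (by simpa using hm), List.foldr_cons,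
    List.getElem_ofFn]
  rfl

theorem isTame_monomialFrom (lam : ℝ) {N : ℕ} (ε : Fin N → Fin 2) (t : Fin N → ℝ)
    (j : Fin N → Fin 3) (f : Fin N → 𝓢(Mom, ℂ)) (m : ℕ) :
    IsTame (fun _ : Unit => 1) fun _ =>
      monomialFrom lam ε t j (fun i => ⇑(f i)) m (vacuumVector fun _ => 1) := by
  obtain hm | hm := le_total N m
  · rw [monomialFrom_of_le lam ε t j _ hm]
    exact isTame_vacuumVector
  · induction hm using Nat.decreasingInduction with
    | self =>
      rw [monomialFrom_of_le lam ε t j _ le_rfl]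
      exact isTame_vacuumVector
    | of_succ m hm ih =>
      rw [monomialFrom_of_lt lam ε t j _ hm]
      exact ih.smearedOp lam _ _ _ _

/-! ### The conservation law and the reduction to constant amplitude. -/

/-- The difference of particle momentum and total field momentum is conserved by the collective
operators. -/
def HasAmplitude (ψ : Mom → ℂ) (Ψ Φ : FockFn) : Prop :=
  ∀ n p x, Ψ n p x = ψ (p - ∑ i : Fin n, (x i).1) * Φ n p x

theorem hasAmplitude_vacuumVector (ψ : Mom → ℂ) :
    HasAmplitude ψ (vacuumVector ψ) (vacuumVector fun _ => 1) := by
  intro n p x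
  cases n <;> simp [vacuumVector]

theorem HasAmplitude.collectiveAnnihilator {ψ : Mom → ℂ} {Ψ Φ : FockFn} (h : HasAmplitude ψ Ψ Φ)
    (lam t : ℝ) (j : Fin 3) (k : Mom) :
    HasAmplitude ψ (collectiveAnnihilator lam t j k Ψ) (collectiveAnnihilator lam t j k Φ) := by
  intro n p x
  rw [collectiveAnnihilator_apply, collectiveAnnihilator_apply, h]
  simp only [Fin.sum_univ_succ, Fin.cons_zero, Fin.cons_succ, add_sub_add_right_eq_sub,
    add_comm k]
  ring

/-- By conservation the value of `ψ` is independent of the integration variable, so it leaves the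
integral with no regularity of `ψ`. -/
theorem HasAmplitude.smearedOp {ψ : Mom → ℂ} {Ψ Φ : FockFn} (h : HasAmplitude ψ Ψ Φ)
    (lam : ℝ) (ε : Fin 2) (t : ℝ) (j : Fin 3) (f : Mom → ℂ) :
    HasAmplitude ψ (smearedOp lam ε t j f Ψ) (smearedOp lam ε t j f Φ) := by
  unfold _root_.smearedOp
  intro n p x
  split_ifs
  · simp only [smearedAnnihilator]
    rw [← integral_const_mul]
    refine integral_congr_ae (.of_forall fun k => ?_)
    simp only [h.collectiveAnnihilator lam t j k n p x]
    ring
  · cases n with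
    | zero => simp only [smearedCreator_zero, mul_zero]
    | succ n =>
      simp only [smearedCreator_succ, Finset.mul_sum]
      refine Finset.sum_congr rfl fun i _ => ?_
      split_ifs
      · rw [h, Fin.sum_univ_succAbove _ i, ← sub_sub]
        simp only [Fin.removeNth]
        ring
      · simp

theorem hasAmplitude_monomialFrom (lam : ℝ) {N : ℕ} (ε : Fin N → Fin 2) (t : Fin N → ℝ)
    (j : Fin N → Fin 3) (f : Fin N → Mom → ℂ) (ψ : Mom → ℂ) (m : ℕ) :
    HasAmplitude ψ (monomialFrom lam ε t j f m (vacuumVector ψ))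
      (monomialFrom lam ε t j f m (vacuumVector fun _ => 1)) := by
  obtain hm | hm := le_total N m
  · rw [monomialFrom_of_le lam ε t j _ hm]
    exact hasAmplitude_vacuumVector ψ
  · induction hm using Nat.decreasingInduction with
    | self =>
      rw [monomialFrom_of_le lam ε t j _ le_rfl]
      exact hasAmplitude_vacuumVector ψ
    | of_succ m hm ih =>
      rw [monomialFrom_of_lt lam ε t j _ hm]
      exact ih.smearedOp lam _ _ _ _

theorem integrable_collectiveAnnihilator_monomialFrom (lam : ℝ) {N : ℕ} (ε : Fin N → Fin 2)
    (t : Fin N → ℝ) (j : Fin N → Fin 3) (f : Fin N → 𝓢(Mom, ℂ)) (ψ : Mom → ℂ) (s : ℝ)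
    (l : Fin 3) (g : 𝓢(Mom, ℂ)) (m n : ℕ) (p : Mom) (x : Fin n → Mom × Fin 3) :
    Integrable fun k : Mom => g k * collectiveAnnihilator lam s l k
      (monomialFrom lam ε t j (fun i => ⇑(f i)) m (vacuumVector ψ)) n p x := by
  refine (((isTame_monomialFrom lam ε t j f m).integrable_annihilator lam s l g () n p
    x).const_mul (ψ (p - ∑ i : Fin n, (x i).1))).congr (.of_forall fun k => ?_)
  simp only [((hasAmplitude_monomialFrom lam ε t j _ ψ m).collectiveAnnihilator lam s l k) n p x]
  ring

/-! ### Moving the annihilation integrals to the front. -/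

noncomputable section

/-- The operator under the smearing integral: the annihilator at the sharp momentum `k`, with its
test function, or the smeared creator. -/
def sharpOp (lam : ℝ) (ε : Fin 2) (t : ℝ) (j : Fin 3) (f : Mom → ℂ) (k : Mom) (Ψ : FockFn) :
    FockFn :=
  if ε = 0 then fun n p x => f k * collectiveAnnihilator lam t j k Ψ n p x
  else smearedCreator lam t j f Ψ

/-- The analogue of `monomialFrom` with annihilators at the sharp momenta `κ`. -/
def sharpMonomialFrom (lam : ℝ) {N : ℕ} (ε : Fin N → Fin 2) (t : Fin N → ℝ) (j : Fin N → Fin 3)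
    (f : Fin N → Mom → ℂ) (κ : Fin N → Mom) (m₀ : ℕ) : FockFn → FockFn :=
  ((List.ofFn fun m => sharpOp lam (ε m) (t m) (j m) (f m) (κ m)).drop m₀).foldr (· ∘ ·) id

/-- The measure for the momentum variable of an operator: Lebesgue measure for annihilators; the
variable of a creator is unused. -/
def momentumMeasure (ε : Fin 2) : Measure Mom :=
  if ε = 0 then volume else Measure.dirac 0

instance (ε : Fin 2) : SigmaFinite (momentumMeasure ε) := by
  unfold momentumMeasure
  split_ifs <;> infer_instance

/-- The norm of the test function of an annihilator. -/
def annihilatorWeight (ε : Fin 2) (f : Mom → ℂ) (k : Mom) : ℝ := if ε = 0 then ‖f k‖ else 1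

theorem integrable_annihilatorWeight (ε : Fin 2) (f : 𝓢(Mom, ℂ)) :
    Integrable (annihilatorWeight ε f) (momentumMeasure ε) := by
  unfold annihilatorWeight momentumMeasure
  split_ifs
  · exact f.integrable.norm
  · exact integrable_const _

section

variable {Θ : Type*} [MeasurableSpace Θ]

theorem IsTame.comp {Θ' : Type*} [MeasurableSpace Θ'] {g : Θ → ℝ} {V : Θ → FockFn}
    (hV : IsTame g V) {φ : Θ' → Θ} (hφ : Measurable φ) :
    IsTame (fun θ => g (φ θ)) fun θ => V (φ θ) where
  measurable n := (hV.measurable n).comp ((hφ.comp measurable_fst).prodMk measurable_snd)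
  bound n := by
    obtain ⟨C, hC, h⟩ := hV.bound n
    exact ⟨C, hC, fun θ => h (φ θ)⟩

theorem IsTame.integrable {g : Θ → ℝ} {V : Θ → FockFn} (hV : IsTame g V) {ν : Measure Θ}
    (hg : Integrable g ν) (n : ℕ) (p : Mom) (x : Fin n → Mom × Fin 3) :
    Integrable (fun θ => V θ n p x) ν := by
  obtain ⟨C, -, h⟩ := hV.bound n
  have hm : Measurable fun θ : Θ => (θ, p, x) := measurable_id.prodMk measurable_const
  exact (hg.const_mul C).mono' ((hV.measurable n).comp hm).aestronglyMeasurable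
    (.of_forall fun θ => h θ p x)

theorem IsTame.sharpOp {g : Θ → ℝ} {V : Θ → FockFn} (hV : IsTame g V) (lam : ℝ) (ε : Fin 2)
    (t : ℝ) (j : Fin 3) (f : 𝓢(Mom, ℂ)) :
    IsTame (fun z : Mom × Θ => annihilatorWeight ε f z.1 * g z.2)
      fun z => sharpOp lam ε t j f z.1 (V z.2) := by
  unfold _root_.sharpOp annihilatorWeight
  split_ifs
  · refine ⟨fun n => ?_, fun n => ?_⟩
    · have hf : Measurable fun z : (Mom × Θ) × Mom × (Fin n → Mom × Fin 3) => f z.1.1 :=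
        f.continuous.measurable.comp (measurable_fst.comp measurable_fst)
      have hm : Measurable fun z : (Mom × Θ) × Mom × (Fin n → Mom × Fin 3) =>
          ((z.1.2, z.2), z.1.1) :=
        ((measurable_snd.comp measurable_fst).prodMk measurable_snd).prodMk
          (measurable_fst.comp measurable_fst)
      have hc := (hV.measurable_collectiveAnnihilator lam t j n).comp hm
      simp only [Function.comp_def] at hc
      exact hf.mul hc
    · obtain ⟨C, hC, h⟩ := hV.exists_norm_collectiveAnnihilator_le lam t j n
      refine ⟨C, hC, fun z p x => ?_⟩
      rw [norm_mul, mul_left_comm]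
      exact mul_le_mul_of_nonneg_left (h _ _ _ _) (norm_nonneg _)
  · simp only [one_mul]
    exact (hV.smearedCreator lam t j f).comp measurable_snd

/-- An annihilator contributes a new integration variable, by Fubini. A creator is a finite sum,
hence commutes with the integral, and its dummy variable has a Dirac measure. -/
theorem smearedOp_integral {g : Θ → ℝ} {V : Θ → FockFn} (hV : IsTame g V) {ν : Measure Θ}
    [SigmaFinite ν] (hg : Integrable g ν) (lam : ℝ) (ε : Fin 2) (t : ℝ) (j : Fin 3)
    (f : 𝓢(Mom, ℂ)) (n : ℕ) (p : Mom) (x : Fin n → Mom × Fin 3) :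
    smearedOp lam ε t j f (fun n p x => ∫ θ, V θ n p x ∂ν) n p x =
      ∫ z, sharpOp lam ε t j f z.1 (V z.2) n p x ∂((momentumMeasure ε).prod ν) := by
  rw [integral_prod _ ((hV.sharpOp lam ε t j f).integrable
    ((integrable_annihilatorWeight ε f).mul_prod hg) n p x)]
  unfold smearedOp sharpOp momentumMeasure
  split_ifs
  · simp only [smearedAnnihilator, collectiveAnnihilator_apply, integral_const_mul]
  · rw [integral_dirac]
    cases n with
    | zero => simp only [smearedCreator_zero, integral_zero]
    | succ n =>
      simp only [smearedCreator_succ, integral_const_mul]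
      rw [integral_finsetSum]
      · congr 1
        refine Finset.sum_congr rfl fun i _ => ?_
        split_ifs
        · rw [integral_const_mul]
        · rw [integral_zero]
      · intro i _
        split_ifs
        · exact (hV.integrable hg _ _ _).const_mul _
        · exact integrable_zero _ _ _

end

theorem sharpMonomialFrom_zero_succ (lam : ℝ) {N : ℕ} (ε : Fin (N + 1) → Fin 2)
    (t : Fin (N + 1) → ℝ) (j : Fin (N + 1) → Fin 3) (f : Fin (N + 1) → Mom → ℂ)
    (κ : Fin (N + 1) → Mom) :
    sharpMonomialFrom lam ε t j f κ 0 = sharpOp lam (ε 0) (t 0) (j 0) (f 0) (κ 0) ∘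
      sharpMonomialFrom lam (fun i => ε i.succ) (fun i => t i.succ) (fun i => j i.succ)
        (fun i => f i.succ) (fun i => κ i.succ) 0 := by
  simp only [sharpMonomialFrom, List.drop_zero, List.ofFn_succ, List.foldr_cons]

theorem monomialFrom_zero_succ (lam : ℝ) {N : ℕ} (ε : Fin (N + 1) → Fin 2)
    (t : Fin (N + 1) → ℝ) (j : Fin (N + 1) → Fin 3) (f : Fin (N + 1) → Mom → ℂ) :
    monomialFrom lam ε t j f 0 = smearedOp lam (ε 0) (t 0) (j 0) (f 0) ∘
      monomialFrom lam (fun i => ε i.succ) (fun i => t i.succ) (fun i => j i.succ)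
        (fun i => f i.succ) 0 := by
  simp only [monomialFrom, List.drop_zero, List.ofFn_succ, List.foldr_cons]

theorem isTame_sharpMonomialFrom (lam : ℝ) {N : ℕ} (ε : Fin N → Fin 2) (t : Fin N → ℝ)
    (j : Fin N → Fin 3) (f : Fin N → 𝓢(Mom, ℂ)) :
    IsTame (fun κ : Fin N → Mom => ∏ i, annihilatorWeight (ε i) (f i) (κ i)) fun κ =>
      sharpMonomialFrom lam ε t j (fun i => ⇑(f i)) κ 0 (vacuumVector fun _ => 1) := by
  induction N with
  | zero =>
    simp only [sharpMonomialFrom, List.ofFn_zero, List.drop_nil, List.foldr_nil, id_eq,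
      Finset.univ_eq_empty, Finset.prod_empty]
    exact isTame_vacuumVector
  | succ N ih =>
    simp only [sharpMonomialFrom_zero_succ, Fin.prod_univ_succ, Function.comp_apply]
    exact ((ih (fun i => ε i.succ) (fun i => t i.succ) (fun i => j i.succ)
      (fun i => f i.succ)).sharpOp lam (ε 0) (t 0) (j 0) (f 0)).comp
      ((measurable_pi_apply 0).prodMk (measurable_pi_lambda _ fun i => measurable_pi_apply i.succ) :
        Measurable fun κ : Fin (N + 1) → Mom => (κ 0, fun i : Fin N => κ i.succ))

theorem integrable_prod_annihilatorWeight {N : ℕ} (ε : Fin N → Fin 2) (f : Fin N → 𝓢(Mom, ℂ)) :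
    Integrable (fun κ : Fin N → Mom => ∏ i, annihilatorWeight (ε i) (f i) (κ i))
      (Measure.pi fun i => momentumMeasure (ε i)) :=
  Integrable.fintype_prod fun i => integrable_annihilatorWeight (ε i) (f i)

theorem monomialFrom_zero_eq_integral (lam : ℝ) {N : ℕ} (ε : Fin N → Fin 2) (t : Fin N → ℝ)
    (j : Fin N → Fin 3) (f : Fin N → 𝓢(Mom, ℂ)) (n : ℕ) (p : Mom) (x : Fin n → Mom × Fin 3) :
    monomialFrom lam ε t j (fun i => ⇑(f i)) 0 (vacuumVector fun _ => 1) n p x =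
      ∫ κ, sharpMonomialFrom lam ε t j (fun i => ⇑(f i)) κ 0 (vacuumVector fun _ => 1) n p x
        ∂(Measure.pi fun i => momentumMeasure (ε i)) := by
  induction N generalizing n p with
  | zero =>
    rw [Measure.pi_of_empty _ finZeroElim]
    simp [sharpMonomialFrom, monomialFrom]
  | succ N ih =>
    rw [monomialFrom_zero_succ, Function.comp_apply]
    have h : monomialFrom lam (fun i => ε i.succ) (fun i => t i.succ) (fun i => j i.succ)
        (fun i => ⇑(f i.succ)) 0 (vacuumVector fun _ => 1) = fun n p x => ∫ κ,
          sharpMonomialFrom lam (fun i => ε i.succ) (fun i => t i.succ) (fun i => j i.succ)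
            (fun i => ⇑(f i.succ)) κ 0 (vacuumVector fun _ => 1) n p x
            ∂(Measure.pi fun i : Fin N => momentumMeasure (ε i.succ)) := by
      funext n p x
      exact ih _ _ _ (fun i => f i.succ) n p x
    rw [h, smearedOp_integral (isTame_sharpMonomialFrom lam (fun i => ε i.succ)
      (fun i => t i.succ) (fun i => j i.succ) (fun i => f i.succ))
      (integrable_prod_annihilatorWeight (fun i => ε i.succ) (fun i => f i.succ))]
    refine ((measurePreserving_piFinSuccAbove (fun i => momentumMeasure (ε i)) 0).integral_comp'
      (fun z => sharpOp lam (ε 0) (t 0) (j 0) (f 0) z.1 (sharpMonomialFrom lam (fun i => ε i.succ)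
        (fun i => t i.succ) (fun i => j i.succ) (fun i => ⇑(f i.succ)) z.2 0
        (vacuumVector fun _ => 1)) n p x)).symm.trans ?_
    simp only [sharpMonomialFrom_zero_succ]
    rfl

theorem sharpMonomialFrom_of_le (lam : ℝ) {N : ℕ} (ε : Fin N → Fin 2) (t : Fin N → ℝ)
    (j : Fin N → Fin 3) (f : Fin N → Mom → ℂ) (κ : Fin N → Mom) {m : ℕ} (hm : N ≤ m) :
    sharpMonomialFrom lam ε t j f κ m = id := by
  rw [sharpMonomialFrom, List.drop_eq_nil_of_le (by simpa using hm), List.foldr_nil]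

theorem sharpMonomialFrom_of_lt (lam : ℝ) {N : ℕ} (ε : Fin N → Fin 2) (t : Fin N → ℝ)
    (j : Fin N → Fin 3) (f : Fin N → Mom → ℂ) (κ : Fin N → Mom) {m : ℕ} (hm : m < N) :
    sharpMonomialFrom lam ε t j f κ m =
      sharpOp lam (ε ⟨m, hm⟩) (t ⟨m, hm⟩) (j ⟨m, hm⟩) (f ⟨m, hm⟩) (κ ⟨m, hm⟩) ∘
      sharpMonomialFrom lam ε t j f κ (m + 1) := by
  rw [sharpMonomialFrom, List.drop_eq_getElem_cons (by simpa using hm), List.foldr_cons,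
    List.getElem_ofFn]
  rfl

end

/-! ### Combinatorics of contractions. -/

noncomputable section

/-- `ρ` sends every creator at a position `≥ m` to an earlier annihilator, bijectively onto the
annihilators that are at positions `≥ m` or in `U`; all other positions are fixed. -/
structure IsContraction {N : ℕ} (ε : Fin N → Fin 2) (m : ℕ) (U : Finset (Fin N))
    (ρ : Fin N → Fin N) : Prop where
  fixed : ∀ c : Fin N, c.val < m ∨ ε c = 0 → ρ c = c
  ann : ∀ c : Fin N, m ≤ c.val → ε c = 1 → ε (ρ c) = 0
  lt : ∀ c : Fin N, m ≤ c.val → ε c = 1 → ρ c < c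
  mem : ∀ c : Fin N, m ≤ c.val → ε c = 1 → m ≤ (ρ c).val ∨ ρ c ∈ U
  inj : ∀ c c' : Fin N, m ≤ c.val → ε c = 1 → m ≤ c'.val → ε c' = 1 → ρ c = ρ c' → c = c'
  surj : ∀ a : Fin N, ε a = 0 → m ≤ a.val ∨ a ∈ U → ∃ c : Fin N, m ≤ c.val ∧ ε c = 1 ∧ ρ c = a

open scoped Classical in
/-- The finite set of all `IsContraction` maps. -/
def contractions {N : ℕ} (ε : Fin N → Fin 2) (m : ℕ) (U : Finset (Fin N)) :
    Finset (Fin N → Fin N) :=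
  Finset.univ.filter (IsContraction ε m U)

theorem mem_contractions {N : ℕ} {ε : Fin N → Fin 2} {m : ℕ} {U : Finset (Fin N)}
    {ρ : Fin N → Fin N} : ρ ∈ contractions ε m U ↔ IsContraction ε m U ρ := by
  simp [contractions]

/-- The annihilators before the position `i` that are contracted with a creator after `i`. -/
def spectators {N : ℕ} (ε : Fin N → Fin 2) (ρ : Fin N → Fin N) (i : Fin N) : Finset (Fin N) :=
  Finset.univ.filter fun a => a < i ∧ ε a = 0 ∧ ∃ c, i < c ∧ ε c = 1 ∧ ρ c = a

/-- The contribution of position `i` to the contraction `ρ`, for the conserved difference `P` of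
particle and field momentum. -/
def contractionFactor (lam : ℝ) {N : ℕ} (ε : Fin N → Fin 2) (t : Fin N → ℝ) (j : Fin N → Fin 3)
    (f : Fin N → Mom → ℂ) (κ : Fin N → Mom) (P : Mom) (ρ : Fin N → Fin N) (i : Fin N) : ℂ :=
  (lam : ℂ)⁻¹ * (if j (ρ i) = j i then f i (κ (ρ i)) else 0) *
    qFactor lam (if ε i = 0 then t i else -t i) (omegaTilde (κ (ρ i)) +
      inner ℝ (κ (ρ i)) (P + ∑ a ∈ spectators ε ρ i, κ a))

section

variable {N : ℕ} {ε : Fin N → Fin 2} {U : Finset (Fin N)} {i : Fin N}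

theorem fin_two_eq_zero_or_one (e : Fin 2) : e = 0 ∨ e = 1 := by
  omega

/-- When the cut passes the annihilator `i`, this position moves from the part right of the cut into
`U`; the set of annihilators to be contracted is unchanged. -/
theorem isContraction_ann_iff (hi : ε i = 0) (ρ : Fin N → Fin N) :
    IsContraction ε i U ρ ↔ IsContraction ε (i + 1) (insert i U) ρ := by
  have key : ∀ c : Fin N, ε c = 1 → (i.val ≤ c.val ↔ i.val + 1 ≤ c.val) := by
    intro c hc
    have : c ≠ i := by rintro rfl; simp [hi] at hc
    have : c.val ≠ i.val := fun h => this (Fin.ext h)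
    omega
  have key2 : ∀ a : Fin N, (i.val ≤ a.val ∨ a ∈ U) ↔ (i.val + 1 ≤ a.val ∨ a ∈ insert i U) := by
    intro a
    rw [Finset.mem_insert, Fin.ext_iff]
    constructor
    · rintro (h | h)
      · omega
      · exact .inr (.inr h)
    · rintro (h | h | h)
      · omega
      · omega
      · exact .inr h
  have key3 : ∀ c : Fin N, (c.val < i.val ∨ ε c = 0) ↔ (c.val < i.val + 1 ∨ ε c = 0) := by
    intro c
    constructor
    · rintro (h | h)
      · omega
      · exact .inr h
    · rintro (h | h)
      · by_cases hc : c = i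
        · exact .inr (hc ▸ hi)
        · have : c.val ≠ i.val := fun h => hc (Fin.ext h)
          omega
      · exact .inr h
  constructor
  · intro h
    exact ⟨fun c hc => h.fixed c ((key3 c).2 hc), fun c h1 h2 => h.ann c ((key c h2).2 h1) h2,
      fun c h1 h2 => h.lt c ((key c h2).2 h1) h2,
      fun c h1 h2 => (key2 _).1 (h.mem c ((key c h2).2 h1) h2),
      fun c c' h1 h2 h3 h4 => h.inj c c' ((key c h2).2 h1) h2 ((key c' h4).2 h3) h4,
      fun a ha h' => by
        obtain ⟨c, h1, h2, h3⟩ := h.surj a ha ((key2 a).2 h')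
        exact ⟨c, (key c h2).1 h1, h2, h3⟩⟩
  · intro h
    exact ⟨fun c hc => h.fixed c ((key3 c).1 hc), fun c h1 h2 => h.ann c ((key c h2).1 h1) h2,
      fun c h1 h2 => h.lt c ((key c h2).1 h1) h2,
      fun c h1 h2 => (key2 _).2 (h.mem c ((key c h2).1 h1) h2),
      fun c c' h1 h2 h3 h4 => h.inj c c' ((key c h2).1 h1) h2 ((key c' h4).1 h3) h4,
      fun a ha h' => by
        obtain ⟨c, h1, h2, h3⟩ := h.surj a ha ((key2 a).1 h')
        exact ⟨c, (key c h2).2 h1, h2, h3⟩⟩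

theorem contractions_ann (hi : ε i = 0) :
    contractions ε i U = contractions ε (i + 1) (insert i U) := by
  ext ρ
  rw [mem_contractions, mem_contractions, isContraction_ann_iff hi]

theorem IsContraction.apply_mem_of_cre {ρ : Fin N → Fin N} (h : IsContraction ε i U ρ)
    (hi : ε i = 1) : ρ i ∈ U := by
  have h1 := h.lt i le_rfl hi
  have h2 := h.mem i le_rfl hi
  rw [Fin.lt_def] at h1
  exact h2.resolve_left (by omega)

/-- Behind the cut every position must be fixed, so the value at the creator `i` is reset to `i` and
its partner is used up. -/
theorem IsContraction.update_of_cre {ρ : Fin N → Fin N} (h : IsContraction ε i U ρ)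
    (hi : ε i = 1) :
    IsContraction ε (i + 1) (U.erase (ρ i)) (Function.update ρ i i) := by
  have hne : ∀ c : Fin N, i.val + 1 ≤ c.val → c ≠ i := by
    rintro c hc rfl
    omega
  refine ⟨fun c hc => ?_, fun c h1 h2 => ?_, fun c h1 h2 => ?_, fun c h1 h2 => ?_,
    fun c c' h1 h2 h3 h4 h5 => ?_, fun a ha h' => ?_⟩
  · by_cases hci : c = i
    · rw [hci, Function.update_self]
    · rw [Function.update_of_ne hci]
      have : c.val ≠ i.val := fun h => hci (Fin.ext h)
      exact h.fixed c (hc.imp_left (by omega))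
  · rw [Function.update_of_ne (hne c h1)]
    exact h.ann c (by omega) h2
  · rw [Function.update_of_ne (hne c h1)]
    exact h.lt c (by omega) h2
  · rw [Function.update_of_ne (hne c h1)]
    have h3 : ρ c ≠ ρ i := fun h3 => hne c h1 (h.inj c i (by omega) h2 le_rfl hi h3)
    have h4 : ρ c ≠ i := by
      intro h4
      have := h.ann c (by omega) h2
      rw [h4, hi] at this
      exact one_ne_zero this
    have h5 : (ρ c).val ≠ i.val := fun h => h4 (Fin.ext h)
    rcases h.mem c (by omega) h2 with h6 | h6
    · exact .inl (by omega)
    · exact .inr (Finset.mem_erase.2 ⟨h3, h6⟩)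
  · rw [Function.update_of_ne (hne c h1), Function.update_of_ne (hne c' h3)] at h5
    exact h.inj c c' (by omega) h2 (by omega) h4 h5
  · obtain ⟨c, h1, h2, h3⟩ := h.surj a ha
      (h'.imp (by omega) fun h => Finset.mem_of_mem_erase h)
    have hci : c ≠ i := by
      rintro rfl
      rcases h' with h' | h'
      · have := h.lt c le_rfl hi
        rw [Fin.lt_def, h3] at this
        omega
      · exact (Finset.ne_of_mem_erase h') h3.symm
    have : c.val ≠ i.val := fun h => hci (Fin.ext h)
    exact ⟨c, by omega, h2, by rw [Function.update_of_ne hci, h3]⟩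

theorem IsContraction.update_cre {ρ : Fin N → Fin N} {a : Fin N} (hi : ε i = 1) (ha : a ∈ U)
    (hU : ∀ b ∈ U, ε b = 0 ∧ b < i) (h : IsContraction ε (i + 1) (U.erase a) ρ) :
    IsContraction ε i U (Function.update ρ i a) := by
  have hne : ∀ c : Fin N, i.val ≤ c.val → c ≠ i → i.val + 1 ≤ c.val := by
    intro c hc hci
    have : c.val ≠ i.val := fun h => hci (Fin.ext h)
    omega
  -- The annihilator `a` lies left of the cut and is erased from `U`, so no later creator can use
  -- it.
  have hρa : ∀ c : Fin N, i.val ≤ c.val → c ≠ i → ε c = 1 → ρ c ≠ a := by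
    rintro c h1 h2 h3 rfl
    have h4 := (hU _ ha).2
    rw [Fin.lt_def] at h4
    rcases h.mem c (hne c h1 h2) h3 with h5 | h5
    · omega
    · exact Finset.notMem_erase _ _ h5
  refine ⟨fun c hc => ?_, fun c h1 h2 => ?_, fun c h1 h2 => ?_, fun c h1 h2 => ?_,
    fun c c' h1 h2 h3 h4 h5 => ?_, fun b hb h' => ?_⟩
  · have hci : c ≠ i := by
      rintro rfl
      rcases hc with hc | hc
      · omega
      · rw [hi] at hc
        exact one_ne_zero hc
    rw [Function.update_of_ne hci]
    exact h.fixed c (hc.imp_left (by omega))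
  · by_cases hci : c = i
    · rw [hci, Function.update_self]
      exact (hU a ha).1
    · rw [Function.update_of_ne hci]
      exact h.ann c (hne c h1 hci) h2
  · by_cases hci : c = i
    · rw [hci, Function.update_self]
      exact (hU a ha).2
    · rw [Function.update_of_ne hci]
      exact h.lt c (hne c h1 hci) h2
  · by_cases hci : c = i
    · rw [hci, Function.update_self]
      exact .inr ha
    · rw [Function.update_of_ne hci]
      exact (h.mem c (hne c h1 hci) h2).imp (by omega) fun h => Finset.mem_of_mem_erase h
  · by_cases hci : c = i <;> by_cases hci' : c' = i
    · rw [hci, hci']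
    · rw [hci, Function.update_self, Function.update_of_ne hci'] at h5
      exact absurd h5.symm (hρa c' h3 hci' h4)
    · rw [hci', Function.update_self, Function.update_of_ne hci] at h5
      exact absurd h5 (hρa c h1 hci h2)
    · rw [Function.update_of_ne hci, Function.update_of_ne hci'] at h5
      exact h.inj c c' (hne c h1 hci) h2 (hne c' h3 hci') h4 h5
  · by_cases hba : b = a
    · exact ⟨i, le_rfl, hi, by rw [Function.update_self, hba]⟩
    · have hbi : b ≠ i := by
        rintro rfl
        rw [hi] at hb
        exact one_ne_zero hb
      obtain ⟨c, h1, h2, h3⟩ := h.surj b hb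
        (h'.imp (fun h => hne b h hbi) fun h => Finset.mem_erase.2 ⟨hba, h⟩)
      have hci : c ≠ i := by
        rintro rfl
        omega
      exact ⟨c, by omega, h2, by rw [Function.update_of_ne hci, h3]⟩

/-- The first creator after the cut can only be contracted with an open annihilator, so the sum
splits according to this partner. -/
theorem sum_contractions_cre {M : Type*} [AddCommMonoid M] (hi : ε i = 1)
    (hU : ∀ b ∈ U, ε b = 0 ∧ b < i) (F : (Fin N → Fin N) → M) :
    ∑ ρ ∈ contractions ε i U, F ρ =
      ∑ a ∈ U, ∑ ρ ∈ contractions ε (i + 1) (U.erase a), F (Function.update ρ i a) := by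
  rw [Finset.sum_sigma']
  refine Finset.sum_bij' (fun ρ _ => ⟨ρ i, Function.update ρ i i⟩)
    (fun z _ => Function.update z.2 i z.1) ?_ ?_ ?_ ?_ ?_
  · intro ρ hρ
    rw [mem_contractions] at hρ
    exact Finset.mem_sigma.2 ⟨hρ.apply_mem_of_cre hi, mem_contractions.2 (hρ.update_of_cre hi)⟩
  · rintro ⟨a, ρ⟩ hz
    obtain ⟨ha, hρ⟩ := Finset.mem_sigma.1 hz
    exact mem_contractions.2 ((mem_contractions.1 hρ).update_cre hi ha hU)
  · intro ρ hρ
    simp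
  · rintro ⟨a, ρ⟩ hz
    obtain ⟨ha, hρ⟩ := Finset.mem_sigma.1 hz
    have : ρ i = i := (mem_contractions.1 hρ).fixed i (.inl (by omega))
    simp only [Function.update_self, Function.update_idem]
    rw [Function.update_eq_self_iff.2 this.symm]
  · intro ρ hρ
    simp

/-- Surjectivity gives every open annihilator in `U` a partner beyond the cut; `i` itself is
excluded by the strict inequality in `spectators`. -/
theorem IsContraction.spectators_ann {ρ : Fin N → Fin N} (h : IsContraction ε (i + 1) (insert i U) ρ)
    (hU : ∀ b ∈ U, ε b = 0 ∧ b < i) : spectators ε ρ i = U := by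
  ext a
  simp only [spectators, Finset.mem_filter, Finset.mem_univ, true_and]
  constructor
  · rintro ⟨h1, h2, c, h3, h4, rfl⟩
    rw [Fin.lt_def] at h1 h3
    rcases h.mem c (by omega) h4 with h5 | h5
    · omega
    · refine (Finset.mem_insert.1 h5).resolve_left fun h6 => ?_
      rw [h6] at h1
      omega
  · intro ha
    obtain ⟨c, h1, h2, h3⟩ := h.surj a (hU a ha).1 (.inr (Finset.mem_insert_of_mem ha))
    exact ⟨(hU a ha).2, (hU a ha).1, c, h1, h2, h3⟩

theorem IsContraction.spectators_cre {ρ : Fin N → Fin N} (h : IsContraction ε (i + 1) U ρ)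
    (hU : ∀ b ∈ U, ε b = 0 ∧ b < i) : spectators ε ρ i = U := by
  ext a
  simp only [spectators, Finset.mem_filter, Finset.mem_univ, true_and]
  constructor
  · rintro ⟨h1, h2, c, h3, h4, rfl⟩
    rw [Fin.lt_def] at h1 h3
    exact (h.mem c (by omega) h4).resolve_left (by omega)
  · intro ha
    obtain ⟨c, h1, h2, h3⟩ := h.surj a (hU a ha).1 (.inr ha)
    exact ⟨(hU a ha).2, (hU a ha).1, c, h1, h2, h3⟩

/-- Only creators strictly after `l` matter, so the value at `i ≤ l` is invisible. -/
theorem spectators_update {ρ : Fin N → Fin N} {a l : Fin N} (hl : i ≤ l) :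
    spectators ε (Function.update ρ i a) l = spectators ε ρ l := by
  ext b
  simp only [spectators, Finset.mem_filter, Finset.mem_univ, true_and]
  refine and_congr_right fun _ => and_congr_right fun _ => exists_congr fun c =>
    and_congr_right fun hc => ?_
  rw [Function.update_of_ne (hl.trans_lt hc).ne']

theorem contractionFactor_update {lam : ℝ} {t : Fin N → ℝ} {j : Fin N → Fin 3}
    {f : Fin N → Mom → ℂ} {κ : Fin N → Mom} {P : Mom} {ρ : Fin N → Fin N} {a l : Fin N}
    (hl : i < l) :
    contractionFactor lam ε t j f κ P (Function.update ρ i a) l =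
      contractionFactor lam ε t j f κ P ρ l := by
  rw [contractionFactor, contractionFactor, spectators_update hl.le,
    Function.update_of_ne hl.ne']

theorem prod_filter_le (F : Fin N → ℂ) (i : Fin N) :
    ∏ l ∈ Finset.univ.filter (fun l : Fin N => i.val ≤ l.val), F l =
      F i * ∏ l ∈ Finset.univ.filter (fun l : Fin N => i.val + 1 ≤ l.val), F l := by
  rw [← Finset.prod_insert (by simp)]
  congr 1
  ext l
  simp only [Finset.mem_filter, Finset.mem_univ, true_and, Finset.mem_insert, Fin.ext_iff]
  omega

end

/-! ### Wick's theorem at sharp momenta. -/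

/-- The bosonic normalizations of both kinds of operators telescope into the prefactor `1 / √n!`. -/
theorem inv_sqrt_factorial_succ (n : ℕ) :
    ((Real.sqrt ((n + 1).factorial : ℝ) : ℝ) : ℂ)⁻¹ =
      (Real.sqrt (n + 1) : ℂ)⁻¹ * ((Real.sqrt (n.factorial : ℝ) : ℝ) : ℂ)⁻¹ := by
  rw [Nat.factorial_succ, Nat.cast_mul, Real.sqrt_mul (by positivity), Complex.ofReal_mul, mul_inv]
  push_cast
  rfl

theorem sqrt_succ_mul_inv_sqrt_factorial_succ (n : ℕ) :
    (Real.sqrt (n + 1) : ℂ) * ((Real.sqrt ((n + 1).factorial : ℝ) : ℝ) : ℂ)⁻¹ =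
      ((Real.sqrt (n.factorial : ℝ) : ℝ) : ℂ)⁻¹ := by
  rw [inv_sqrt_factorial_succ, mul_inv_cancel_left₀]
  exact_mod_cast (Real.sqrt_pos.2 (by positivity)).ne'

/-- Wick's theorem for the collective operators, in all sectors. -/
theorem sharpMonomialFrom_apply (lam : ℝ) {N : ℕ} (ε : Fin N → Fin 2) (t : Fin N → ℝ)
    (j : Fin N → Fin 3) (f : Fin N → Mom → ℂ) (κ : Fin N → Mom) {m : ℕ} (hm : m ≤ N) (n : ℕ)
    (u : Fin n → Fin N) (hu : Function.Injective u) (hu' : ∀ l, ε (u l) = 0 ∧ (u l).val < m)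
    (p : Mom) :
    sharpMonomialFrom lam ε t j f κ m (vacuumVector fun _ => 1) n p (fun l => (κ (u l), j (u l))) =
      ((Real.sqrt (n.factorial : ℝ) : ℝ) : ℂ)⁻¹ *
        ∑ ρ ∈ contractions ε m (Finset.univ.image u),
          ∏ i ∈ Finset.univ.filter (fun i : Fin N => m ≤ i.val),
            contractionFactor lam ε t j f κ (p - ∑ l, κ (u l)) ρ i := by
  induction hm using Nat.decreasingInduction generalizing n p with
  | self =>
    rw [sharpMonomialFrom_of_le _ _ _ _ _ _ le_rfl, id_eq]
    have hN : Finset.univ.filter (fun i : Fin N => N ≤ i.val) = ∅ :=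
      Finset.filter_eq_empty_iff.2 fun i _ => by omega
    rw [hN]
    cases n with
    | zero =>
      have : contractions ε N (Finset.univ.image u) = {id} := by
        ext ρ
        rw [mem_contractions, Finset.mem_singleton]
        constructor
        · intro h
          funext c
          exact h.fixed c (.inl c.isLt)
        · rintro rfl
          exact ⟨fun _ _ => rfl, fun c h => by omega, fun c h => by omega, fun c h => by omega,
            fun c _ h => by omega, fun a _ h => by
              rcases h with h | h
              · omega
              · simp at h⟩
      rw [this]
      simp [vacuumVector]
    | succ n =>
      -- An open annihilator would need a creator beyond the end of the product.
      have : contractions ε N (Finset.univ.image u) = ∅ := by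
        refine Finset.eq_empty_of_forall_notMem fun ρ hρ => ?_
        obtain ⟨c, hc, -⟩ := (mem_contractions.1 hρ).surj (u 0) (hu' 0).1
          (.inr (Finset.mem_image_of_mem _ (Finset.mem_univ _)))
        omega
      rw [this]
      simp [vacuumVector]
  | of_succ m hm ih =>
    rw [sharpMonomialFrom_of_lt _ _ _ _ _ _ hm, Function.comp_apply]
    set i : Fin N := ⟨m, hm⟩ with hi
    have him : m = i.val := rfl
    have hU : ∀ b ∈ Finset.univ.image u, ε b = 0 ∧ b < i := by
      intro b hb
      obtain ⟨l, -, rfl⟩ := Finset.mem_image.1 hb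
      exact hu' l
    rcases fin_two_eq_zero_or_one (ε i) with h0 | h1
    -- Annihilator: `i` joins the list of open annihilators, and `P` is unchanged since `κ i` is
    -- added both to `p` and to the sum.
    · have hcons : (Fin.cons (κ i, j i) fun l => (κ (u l), j (u l)) : Fin (n + 1) → Mom × Fin 3) =
          fun l => (κ ((Fin.cons i u : Fin (n + 1) → Fin N) l),
            j ((Fin.cons i u : Fin (n + 1) → Fin N) l)) := by
        funext l
        cases l using Fin.cases <;> rfl
      have himage : Finset.univ.image (Fin.cons i u : Fin (n + 1) → Fin N) =
          insert i (Finset.univ.image u) := by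
        ext a
        simp [Fin.exists_fin_succ, eq_comm]
      rw [sharpOp, if_pos h0, collectiveAnnihilator_apply, hcons, ih]
      · rw [himage, him, contractions_ann h0, ← sqrt_succ_mul_inv_sqrt_factorial_succ n]
        simp only [Finset.mul_sum]
        refine Finset.sum_congr rfl fun ρ hρ => ?_
        rw [mem_contractions] at hρ
        rw [prod_filter_le, contractionFactor, hρ.spectators_ann hU, hρ.fixed i (.inr h0),
          if_pos rfl, if_pos h0, Finset.sum_image fun _ _ _ _ h => hu h, sub_add_cancel,
          Fin.sum_univ_succ]
        simp only [Fin.cons_zero, Fin.cons_succ, add_comm p, add_sub_add_left_eq_sub]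
        ring
      · rw [Fin.cons_injective_iff]
        refine ⟨?_, hu⟩
        rintro ⟨l, hl⟩
        have := (hu' l).2
        rw [hl] at this
        simp [hi] at this
      · intro l
        cases l using Fin.cases with
        | zero => exact ⟨h0, Nat.lt_succ_self m⟩
        | succ l => exact ⟨(hu' l).1, (hu' l).2.trans (Nat.lt_succ_self m)⟩
    · have h1' : ε i ≠ 0 := by
        rw [h1]
        exact one_ne_zero
      rw [sharpOp, if_neg h1']
      cases n with
      | zero =>
        have : contractions ε m (Finset.univ.image u) = ∅ := by
          refine Finset.eq_empty_of_forall_notMem fun ρ hρ => ?_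
          have := (mem_contractions.1 hρ).apply_mem_of_cre (i := i) h1
          simp at this
        rw [smearedCreator_zero, this, Finset.sum_empty, mul_zero]
      | succ n =>
        -- Creator: the term that removes the quantum `l` matches the contractions in which the
        -- partner of `i` is `u l`.
        rw [smearedCreator_succ, him, sum_contractions_cre h1 hU,
          Finset.sum_image fun _ _ _ _ h => hu h, inv_sqrt_factorial_succ, Finset.mul_sum,
          Finset.mul_sum]
        refine Finset.sum_congr rfl fun l _ => ?_
        have himage : (Finset.univ.image u).erase (u l) =
            Finset.univ.image fun r => u (l.succAbove r) := by
          ext a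
          simp only [Finset.mem_erase, Finset.mem_image, Finset.mem_univ, true_and]
          constructor
          · rintro ⟨h2, r, rfl⟩
            obtain ⟨s, rfl⟩ := Fin.exists_succAbove_eq (x := r) (y := l) fun h => h2 (by rw [h])
            exact ⟨s, rfl⟩
          · rintro ⟨s, rfl⟩
            exact ⟨fun h => Fin.succAbove_ne l s (hu h), _, rfl⟩
        have hih := ih n (fun r => u (l.succAbove r)) (hu.comp Fin.succAbove_right_injective)
          (fun r => ⟨(hu' _).1, (hu' _).2.trans (Nat.lt_succ_self m)⟩) (p - κ (u l))
        have hrem : (l.removeNth fun l => (κ (u l), j (u l))) =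
            fun r => (κ (u (l.succAbove r)), j (u (l.succAbove r))) := rfl
        rw [hrem, hih, himage]
        simp only [Finset.mul_sum]
        have hmain : ∀ ρ ∈ contractions ε (m + 1) (Finset.univ.image fun r => u (l.succAbove r)),
            ∏ c ∈ Finset.univ.filter (fun c : Fin N => i.val ≤ c.val),
              contractionFactor lam ε t j f κ (p - ∑ l, κ (u l)) (Function.update ρ i (u l)) c =
            (lam : ℂ)⁻¹ * (if j (u l) = j i then f i (κ (u l)) else 0) *
              qFactor lam (-t i) (omegaTilde (κ (u l)) + inner ℝ (κ (u l)) (p - κ (u l))) *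
              ∏ c ∈ Finset.univ.filter (fun c : Fin N => m + 1 ≤ c.val),
                contractionFactor lam ε t j f κ
                  (p - κ (u l) - ∑ r, κ (u (l.succAbove r))) ρ c := by
          intro ρ hρ
          rw [mem_contractions] at hρ
          have hsum : p - ∑ l, κ (u l) = p - κ (u l) - ∑ r, κ (u (l.succAbove r)) := by
            rw [Fin.sum_univ_succAbove _ l, sub_sub]
          rw [prod_filter_le, hsum]
          congr 1
          · rw [contractionFactor, spectators_update le_rfl, Function.update_self, if_neg h1',
              hρ.spectators_cre (i := i), Finset.sum_image, sub_add_cancel]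
            · exact fun _ _ _ _ h => Fin.succAbove_right_injective (hu h)
            · intro b hb
              rw [← himage] at hb
              exact hU b (Finset.mem_of_mem_erase hb)
          · refine Finset.prod_congr rfl fun c hc => contractionFactor_update ?_
            exact (Finset.mem_filter.1 hc).2
        rw [Finset.sum_congr rfl fun ρ hρ => congrArg _ (hmain ρ hρ)]
        split_ifs
        · rw [Finset.mul_sum]
          refine Finset.sum_congr rfl fun ρ _ => ?_
          ring
        · simp

end

/-! ### From contractions to pair partitions; regrouping of the phases. -/

noncomputable section

section

variable {N : ℕ} {ε : Fin N → Fin 2}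

/-- The pair partition `σ` as a self-map of the positions: creators are sent to their partners and
annihilators are fixed. -/
def contractionOf (σ : Ann ε ≃ Cre ε) (i : Fin N) : Fin N :=
  if h : ε i = 0 then i else (σ.symm ⟨i, (fin_two_eq_zero_or_one _).resolve_left h⟩).1

theorem contractionOf_ann (σ : Ann ε ≃ Cre ε) (a : Ann ε) : contractionOf σ a.1 = a.1 := by
  rw [contractionOf, dif_pos a.2]

theorem Cre.ne_zero (c : Cre ε) : ε c.1 ≠ 0 := by
  rw [c.2]
  exact one_ne_zero

theorem contractionOf_cre (σ : Ann ε ≃ Cre ε) (c : Cre ε) :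
    contractionOf σ c.1 = (σ.symm c).1 := by
  rw [contractionOf, dif_neg c.ne_zero]

theorem isContraction_contractionOf {σ : Ann ε ≃ Cre ε} (hσ : σ ∈ pairPartitions ε) :
    IsContraction ε 0 ∅ (contractionOf σ) := by
  have hlt : ∀ a : Ann ε, a.1 < (σ a).1 := (Finset.mem_filter.1 hσ).2
  refine ⟨fun c hc => ?_, fun c _ h => ?_, fun c _ h => ?_, fun c _ h => .inl (Nat.zero_le _),
    fun c c' _ h _ h' heq => ?_, fun a ha _ => ?_⟩
  · exact contractionOf_ann σ ⟨c, hc.resolve_left (Nat.not_lt_zero _)⟩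
  · rw [contractionOf_cre σ ⟨c, h⟩]
    exact (σ.symm ⟨c, h⟩).2
  · rw [contractionOf_cre σ ⟨c, h⟩]
    simpa using hlt (σ.symm ⟨c, h⟩)
  · rw [contractionOf_cre σ ⟨c, h⟩, contractionOf_cre σ ⟨c', h'⟩] at heq
    exact congrArg Subtype.val (σ.symm.injective (Subtype.ext heq))
  · exact ⟨(σ ⟨a, ha⟩).1, Nat.zero_le _, (σ ⟨a, ha⟩).2, by
      rw [contractionOf_cre, Equiv.symm_apply_apply]⟩

/-- With the cut at 0 and nothing open, a contraction is a bijection from creators to annihilators,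
extended by the identity; `σ` is its inverse. -/
theorem sum_contractions_eq_sum_pairPartitions {M : Type*} [AddCommMonoid M]
    (F : (Fin N → Fin N) → M) :
    ∑ ρ ∈ contractions ε 0 ∅, F ρ = ∑ σ ∈ pairPartitions ε, F (contractionOf σ) := by
  refine (Finset.sum_bij (fun σ _ => contractionOf σ) (fun σ hσ => ?_) (fun σ _ τ _ h => ?_)
    (fun ρ hρ => ?_) fun _ _ => rfl).symm
  · exact mem_contractions.2 (isContraction_contractionOf hσ)
  · refine Equiv.symm_bijective.injective (Equiv.ext fun c => Subtype.ext ?_)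
    rw [← contractionOf_cre, ← contractionOf_cre]
    exact congrFun h c.1
  · rw [mem_contractions] at hρ
    let g : Cre ε → Ann ε := fun c => ⟨ρ c.1, hρ.ann c.1 (Nat.zero_le _) c.2⟩
    have hg : Function.Bijective g := by
      refine ⟨fun c c' h => Subtype.ext ?_, fun a => ?_⟩
      · exact hρ.inj _ _ (Nat.zero_le _) c.2 (Nat.zero_le _) c'.2 (congrArg Subtype.val h)
      · obtain ⟨c, -, h, h'⟩ := hρ.surj a.1 a.2 (.inl (Nat.zero_le _))
        exact ⟨⟨c, h⟩, Subtype.ext h'⟩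
    refine ⟨(Equiv.ofBijective g hg).symm, Finset.mem_filter.2 ⟨Finset.mem_univ _, fun a => ?_⟩,
      funext fun c => ?_⟩
    · obtain ⟨c, rfl⟩ := (Equiv.ofBijective g hg).surjective a
      rw [Equiv.symm_apply_apply]
      exact hρ.lt c.1 (Nat.zero_le _) c.2
    · rcases fin_two_eq_zero_or_one (ε c) with h | h
      · rw [contractionOf_ann _ ⟨c, h⟩, hρ.fixed c (.inr h)]
      · rw [contractionOf_cre _ ⟨c, h⟩]
        rfl

theorem diagonalPoint_ann (σ : Ann ε ≃ Cre ε) (κ : Ann ε → Mom) (a : Ann ε) :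
    diagonalPoint σ κ a.1 = κ a := by
  rw [diagonalPoint, dif_pos a.2]

theorem diagonalPoint_cre (σ : Ann ε ≃ Cre ε) (κ : Ann ε → Mom) (a : Ann ε) :
    diagonalPoint σ κ (σ a).1 = κ a := by
  rw [diagonalPoint, dif_neg (σ a).ne_zero]
  simp

theorem prod_eq_prod_ann_mul (σ : Ann ε ≃ Cre ε) (F : Fin N → ℂ) :
    ∏ i, F i = ∏ a : Ann ε, F a.1 * F (σ a).1 := by
  rw [Finset.prod_mul_distrib, Equiv.prod_comp σ fun c => F c.1,
    ← Fintype.prod_subtype_mul_prod_subtype (fun i => ε i = 0) F]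
  congr 1
  exact Fintype.prod_equiv (Equiv.subtypeEquivRight fun i =>
    ⟨(fin_two_eq_zero_or_one _).resolve_left, fun h => Cre.ne_zero ⟨i, h⟩⟩) _ _ fun _ => rfl

theorem sum_spectators (σ : Ann ε ≃ Cre ε) (i : Fin N) (g : Fin N → Mom) :
    ∑ a ∈ spectators ε (contractionOf σ) i, g a =
      ∑ α ∈ Finset.univ.filter (fun α : Ann ε => α.1 < i ∧ i < (σ α).1), g α.1 := by
  have : spectators ε (contractionOf σ) i = (Finset.univ.filter
      fun α : Ann ε => α.1 < i ∧ i < (σ α).1).map (Function.Embedding.subtype _) := by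
    ext a
    simp only [spectators, Finset.mem_filter, Finset.mem_univ, true_and, Finset.mem_map,
      Function.Embedding.subtype_apply]
    constructor
    · rintro ⟨h1, h2, c, h3, h4, h5⟩
      refine ⟨⟨a, h2⟩, ⟨h1, ?_⟩, rfl⟩
      rw [contractionOf_cre σ ⟨c, h4⟩] at h5
      have : σ ⟨a, h2⟩ = ⟨c, h4⟩ := by
        rw [← Equiv.eq_symm_apply]
        exact Subtype.ext h5.symm
      rwa [this]
    · rintro ⟨α, ⟨h1, h2⟩, rfl⟩
      exact ⟨h1, α.2, (σ α).1, h2, (σ α).2, by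
        rw [contractionOf_cre, Equiv.symm_apply_apply]⟩
  rw [this, Finset.sum_map]
  rfl

/-- The phases of the two operators of one pair. -/
theorem qFactor_pair {σ : Ann ε ≃ Cre ε} (hσ : σ ∈ pairPartitions ε) (lam A s s' : ℝ)
    (h : Ann ε) (p : Mom) (κ : Ann ε → Mom) :
    qFactor lam s (A + inner ℝ (κ h) (p + ∑ α ∈ Finset.univ.filter
        (fun α : Ann ε => α.1 < h.1 ∧ h.1 < (σ α).1), κ α)) *
      qFactor lam (-s') (A + inner ℝ (κ h) (p + ∑ α ∈ Finset.univ.filter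
        (fun α : Ann ε => α.1 < (σ h).1 ∧ (σ h).1 < (σ α).1), κ α)) =
    qFactor lam (s - s') (A + inner ℝ (κ h) p + ∑ α ∈ Finset.univ.filter
        (fun α : Ann ε => α.1 < h.1 ∧ (σ h).1 < (σ α).1), inner ℝ (κ α) (κ h)) *
      ((∏ α ∈ Finset.univ.filter
        (fun α : Ann ε => α.1 < h.1 ∧ h.1 < (σ α).1 ∧ (σ α).1 < (σ h).1),
          qFactor lam s (inner ℝ (κ h) (κ α))) *
      ∏ α ∈ Finset.univ.filter
        (fun α : Ann ε => h.1 < α.1 ∧ α.1 < (σ h).1 ∧ (σ h).1 < (σ α).1),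
          qFactor lam (-s') (inner ℝ (κ α) (κ h))) := by
  have hlt : ∀ a : Ann ε, a.1 < (σ a).1 := (Finset.mem_filter.1 hσ).2
  have hne : ∀ α : Ann ε, (σ α).1 = (σ h).1 → α = h := fun α hα => σ.injective (Subtype.ext hα)
  -- A pair straddling the annihilator `h` either encloses its pair or closes inside it.
  have e1 : ∑ α ∈ Finset.univ.filter (fun α : Ann ε => α.1 < h.1 ∧ h.1 < (σ α).1), κ α =
      ∑ α ∈ Finset.univ.filter (fun α : Ann ε => α.1 < h.1 ∧ (σ h).1 < (σ α).1), κ α +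
      ∑ α ∈ Finset.univ.filter
        (fun α : Ann ε => α.1 < h.1 ∧ h.1 < (σ α).1 ∧ (σ α).1 < (σ h).1), κ α := by
    rw [← Finset.sum_filter_add_sum_filter_not _ (fun α => (σ h).1 < (σ α).1),
      Finset.filter_filter, Finset.filter_filter]
    congr 2
    · refine Finset.filter_congr fun α _ => ⟨fun h' => ⟨h'.1.1, h'.2⟩, fun h' =>
        ⟨⟨h'.1, (hlt h).trans h'.2⟩, h'.2⟩⟩
    · refine Finset.filter_congr fun α _ => ⟨fun h' => ⟨h'.1.1, h'.1.2, ?_⟩, fun h' =>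
        ⟨⟨h'.1, h'.2.1⟩, h'.2.2.not_gt⟩⟩
      refine lt_of_le_of_ne (not_lt.1 h'.2) fun heq => ?_
      rw [hne α heq] at h'
      exact lt_irrefl _ h'.1.1
  -- A pair straddling the creator `σ h` either encloses the pair or opens inside it.
  have e2 : ∑ α ∈ Finset.univ.filter (fun α : Ann ε => α.1 < (σ h).1 ∧ (σ h).1 < (σ α).1), κ α =
      ∑ α ∈ Finset.univ.filter (fun α : Ann ε => α.1 < h.1 ∧ (σ h).1 < (σ α).1), κ α +
      ∑ α ∈ Finset.univ.filter
        (fun α : Ann ε => h.1 < α.1 ∧ α.1 < (σ h).1 ∧ (σ h).1 < (σ α).1), κ α := by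
    rw [← Finset.sum_filter_add_sum_filter_not _ (fun α => α.1 < h.1),
      Finset.filter_filter, Finset.filter_filter]
    congr 2
    · refine Finset.filter_congr fun α _ => ⟨fun h' => ⟨h'.2, h'.1.2⟩, fun h' =>
        ⟨⟨h'.1.trans (hlt h), h'.2⟩, h'.1⟩⟩
    · refine Finset.filter_congr fun α _ => ⟨fun h' => ⟨?_, h'.1⟩, fun h' => ⟨h'.2, h'.1.not_gt⟩⟩
      refine lt_of_le_of_ne (not_lt.1 h'.2) fun heq => ?_
      rw [Subtype.ext heq.symm] at h'
      exact lt_irrefl _ h'.1.2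
  simp only [e1, e2, inner_add_right, inner_sum, sub_eq_add_neg, qFactor_add_right,
    qFactor_add_left, qFactor_sum, real_inner_comm (κ h)]
  simp only [Finset.prod_mul_distrib]
  ring

/-- Each crossing is shared out between its two pairs: `F` is booked at the second one, `G` at the
first. -/
theorem prod_crossing (P : Ann ε → Ann ε → Prop) [DecidableRel P] (F G : Ann ε → Ann ε → ℂ) :
    ∏ c ∈ Finset.univ.filter (fun c : Ann ε × Ann ε => P c.1 c.2), F c.1 c.2 * G c.1 c.2 =
      ∏ h, ((∏ α ∈ Finset.univ.filter (fun α => P α h), F α h) *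
        ∏ α ∈ Finset.univ.filter (fun α => P h α), G h α) := by
  simp only [Finset.prod_mul_distrib, Finset.prod_filter, Fintype.prod_prod_type]
  rw [Finset.prod_comm]

theorem prod_contractionFactor {σ : Ann ε ≃ Cre ε} (hσ : σ ∈ pairPartitions ε) (lam : ℝ)
    (t : Fin N → ℝ) (j : Fin N → Fin 3) (f : Fin N → Mom → ℂ) (κ : Fin N → Mom) (p : Mom) :
    ∏ i, contractionFactor lam ε t j f κ p (contractionOf σ) i =
      (∏ i, f i (diagonalPoint σ (fun a => κ a.1) i)) *
        pairingKernel lam σ t j (diagonalPoint σ fun a => κ a.1) p := by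
  -- In a crossing, one phase comes from the annihilator of the later pair, the other from the
  -- creator of the earlier pair.
  have hcross := prod_crossing
    (fun a b : Ann ε => a.1 < b.1 ∧ b.1 < (σ a).1 ∧ (σ a).1 < (σ b).1)
    (fun a b => qFactor lam (t b.1) (inner ℝ (κ b.1) (κ a.1)))
    (fun a b => qFactor lam (-t (σ a).1) (inner ℝ (κ b.1) (κ a.1)))
  simp only [← qFactor_add_left, ← sub_eq_add_neg] at hcross
  rw [prod_eq_prod_ann_mul σ, prod_eq_prod_ann_mul σ, pairingKernel]
  simp only [diagonalPoint_ann, diagonalPoint_cre]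
  rw [hcross, ← Finset.prod_mul_distrib, ← Finset.prod_mul_distrib]
  refine Finset.prod_congr rfl fun h _ => ?_
  rw [contractionFactor, contractionFactor, contractionOf_ann, contractionOf_cre,
    Equiv.symm_apply_apply, sum_spectators, sum_spectators, if_pos rfl, if_pos h.2,
    if_neg (σ h).ne_zero]
  have hpair := qFactor_pair hσ lam (omegaTilde (κ h.1)) (t h.1) (t (σ h).1) h p fun a => κ a.1
  split_ifs
  · linear_combination ((lam : ℂ) ^ 2)⁻¹ * f h.1 (κ h.1) * f (σ h).1 (κ h.1) * hpair
  · ring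

/-! ### Integration over the diagonal and the vacuum expectation. -/

theorem continuous_diagonalPoint (σ : Ann ε ≃ Cre ε) : Continuous (diagonalPoint σ) := by
  refine continuous_pi fun i => ?_
  unfold diagonalPoint
  split_ifs <;> exact continuous_apply _

theorem continuous_pairingKernel (lam : ℝ) (σ : Ann ε ≃ Cre ε) (t : Fin N → ℝ)
    (j : Fin N → Fin 3) (p : Mom) : Continuous fun k => pairingKernel lam σ t j k p := by
  unfold pairingKernel
  fun_prop

theorem norm_pairingKernel_le (lam : ℝ) (σ : Ann ε ≃ Cre ε) (t : Fin N → ℝ)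
    (j : Fin N → Fin 3) (k : Fin N → Mom) (p : Mom) :
    ‖pairingKernel lam σ t j k p‖ ≤ ∏ _h : Ann ε, ‖((lam : ℂ) ^ 2)⁻¹‖ := by
  rw [pairingKernel, norm_mul, norm_prod, norm_prod]
  simp only [norm_qFactor, Finset.prod_const_one, mul_one, norm_mul]
  refine Finset.prod_le_prod (fun _ _ => by positivity) fun h _ => ?_
  refine mul_le_of_le_one_left (norm_nonneg _) ?_
  split_ifs <;> simp

/-- On the diagonal each momentum enters two test functions; one is integrable, the other bounded,
and the kernel is bounded. -/
theorem integrable_pairing (lam : ℝ) (σ : Ann ε ≃ Cre ε) (t : Fin N → ℝ) (j : Fin N → Fin 3)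
    (f : Fin N → 𝓢(Mom, ℂ)) (p : Mom) :
    Integrable (fun κ => (∏ i, f i (diagonalPoint σ κ i)) *
      pairingKernel lam σ t j (diagonalPoint σ κ) p) (volume : Measure (Ann ε → Mom)) := by
  refine Integrable.mul_bdd (c := ∏ _h : Ann ε, ‖((lam : ℂ) ^ 2)⁻¹‖) ?_
    ((continuous_pairingKernel lam σ t j p).comp
      (continuous_diagonalPoint σ)).aestronglyMeasurable
    (.of_forall fun κ => norm_pairingKernel_le _ _ _ _ _ _)
  simp only [fun κ => prod_eq_prod_ann_mul σ fun i => f i (diagonalPoint σ κ i),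
    diagonalPoint_ann, diagonalPoint_cre]
  refine Integrable.fintype_prod (f := fun (a : Ann ε) k => f a.1 k * f (σ a).1 k) fun a => ?_
  exact (f a.1).integrable.mul_bdd (c := SchwartzMap.seminorm ℝ 0 0 (f (σ a).1))
    (f (σ a).1).continuous.aestronglyMeasurable
    (.of_forall fun k => SchwartzMap.norm_le_seminorm ℝ _ k)

/-- The creator coordinates carry probability measures and integrate out. -/
theorem integral_pi_momentumMeasure (ε : Fin N → Fin 2) (H : (Ann ε → Mom) → ℂ) :
    ∫ κ, H (fun a => κ a.1) ∂(Measure.pi fun i => momentumMeasure (ε i)) = ∫ κ, H κ := by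
  have hprob : IsProbabilityMeasure
      (Measure.pi fun i : {i : Fin N // ¬ε i = 0} => momentumMeasure (ε i.1)) := by
    have (i : {i : Fin N // ¬ε i = 0}) : IsProbabilityMeasure (momentumMeasure (ε i.1)) := by
      rw [momentumMeasure, if_neg i.2]
      infer_instance
    infer_instance
  have hvol : (Measure.pi fun a : Ann ε => momentumMeasure (ε a.1)) = volume := by
    rw [volume_pi]
    congr 1
    funext a
    rw [momentumMeasure, if_pos a.2]
  refine ((measurePreserving_piEquivPiSubtypeProd (fun i => momentumMeasure (ε i))
    fun i => ε i = 0).integral_comp' fun z => H z.1).trans ?_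
  rw [integral_fun_fst, probReal_univ, one_smul, hvol]

theorem vacuumExpectation_monomialFrom (lam : ℝ) (t : Fin N → ℝ) (j : Fin N → Fin 3)
    (f : Fin N → 𝓢(Mom, ℂ)) (ψ : Mom → ℂ) (p : Mom) :
    vacuumExpectation (monomialFrom lam ε t j (fun i => ⇑(f i)) 0) ψ p =
      (∑ σ ∈ pairPartitions ε,
        ∫ k : Fin N → Mom, (∏ i, f i (k i)) * pairingKernel lam σ t j k p ∂(deltaMeasure σ))
      * ψ p := by
  have hsharp (κ : Fin N → Mom) : sharpMonomialFrom lam ε t j (fun i => ⇑(f i)) κ 0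
      (vacuumVector fun _ => 1) 0 p Fin.elim0 = ∑ σ ∈ pairPartitions ε,
        (∏ i, f i (diagonalPoint σ (fun a => κ a.1) i)) *
          pairingKernel lam σ t j (diagonalPoint σ fun a => κ a.1) p := by
    have h := sharpMonomialFrom_apply lam ε t j (fun i => ⇑(f i)) κ (Nat.zero_le N) 0 Fin.elim0
      (fun l => l.elim0) (fun l => l.elim0) p
    have hx : (fun l : Fin 0 => (κ (l.elim0), j (l.elim0))) = Fin.elim0 := funext fun l => l.elim0
    rw [hx] at h
    rw [h]
    simp only [Finset.univ_eq_empty, Finset.image_empty, Finset.sum_empty, sub_zero,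
      Nat.factorial_zero, Nat.cast_one, Real.sqrt_one, Complex.ofReal_one, inv_one, one_mul,
      Nat.zero_le, Finset.filter_true, sum_contractions_eq_sum_pairPartitions]
    exact Finset.sum_congr rfl fun σ hσ => prod_contractionFactor hσ lam t j _ κ p
  -- Without quanta `P` is `p`, whence the factor `ψ p`.
  rw [vacuumExpectation, hasAmplitude_monomialFrom, monomialFrom_zero_eq_integral]
  simp only [hsharp, Finset.univ_eq_empty, Finset.sum_empty, sub_zero]
  rw [mul_comm, integral_pi_momentumMeasure ε fun κ => ∑ σ ∈ pairPartitions ε,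
    (∏ i, f i (diagonalPoint σ κ i)) * pairingKernel lam σ t j (diagonalPoint σ κ) p,
    integral_finsetSum _ fun σ _ => integrable_pairing lam σ t j f p]
  congr 1
  refine Finset.sum_congr rfl fun σ _ => ?_
  rw [deltaMeasure, integral_map (continuous_diagonalPoint σ).aemeasurable]
  refine Continuous.aestronglyMeasurable (Continuous.mul ?_ (continuous_pairingKernel lam σ t j p))
  exact continuous_finsetProd _ fun i _ => (f i).continuous.comp (continuous_apply i)

end

end

theorem theorem1 (lam : ℝ) (hlam : lam ≠ 0) (N : ℕ) (ε : Fin N → Fin 2) (t : Fin N → ℝ)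
    (j : Fin N → Fin 3) (f : Fin N → 𝓢(Mom, ℂ)) (ψ : Mom → ℂ) :
    -- the annihilation integrals in the product applied to `ψ ⊗ Ω` converge absolutely
    (∀ m : Fin N, ε m = 0 → ∀ (n : ℕ) (p : Mom) (x : Fin n → Mom × Fin 3),
      Integrable fun k : Mom => f m k * collectiveAnnihilator lam (t m) (j m) k
        (monomialFrom lam ε t j (fun i => ⇑(f i)) (m + 1) (vacuumVector ψ)) n p x) ∧
    -- unequal numbers of creators and annihilators
    (Fintype.card (Cre ε) ≠ Fintype.card (Ann ε) →
      vacuumExpectation (monomialFrom lam ε t j (fun i => ⇑(f i)) 0) ψ = 0) ∧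
    -- equal numbers
    (∀ n : ℕ, Fintype.card (Cre ε) = n → Fintype.card (Ann ε) = n →
      ∀ p : Mom, vacuumExpectation (monomialFrom lam ε t j (fun i => ⇑(f i)) 0) ψ p =
        (∑ σ ∈ pairPartitions ε,
          ∫ k : Fin N → Mom, (∏ i, f i (k i)) * pairingKernel lam σ t j k p ∂(deltaMeasure σ))
        * ψ p) := by
  refine ⟨fun m _ n p x => ?_, fun hcard => funext fun p => ?_, fun n _ _ p => ?_⟩
  · exact integrable_collectiveAnnihilator_monomialFrom lam ε t j f ψ (t m) (j m) (f m) (m + 1)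
      n p x
  · have hempty : pairPartitions ε = ∅ := Finset.eq_empty_of_forall_notMem fun σ _ =>
      hcard (Fintype.card_congr σ).symm
    rw [vacuumExpectation_monomialFrom, hempty, Finset.sum_empty, zero_mul]
    rfl
  · exact vacuumExpectation_monomialFrom lam t j f ψ p
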